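/- Work in (single-sorted) logic of metric structures: structures are nonempty complete metric spaces of diameter at most $1$, formulas are $[0,1]$-valued, and every function and predicate symbol carries a fixed modulus of uniform continuity. Let $L$ be a separable language, that is, for every $n$ the space of $L$-formulas in $x_0,\dots,x_{n-1}$ is separable for the norm $\|\phi\|_\infty=\sup_{M,\bar a}|\phi(\bar a)^M|$ ($M$ ranges over all $L$-structures, $\bar a$ over the $n$-tuples in $M$). Let $\hat{\mathcal M}(L)$ be the space of codes of separable $L$-structures. With $D$ the set of closed terms of the language obtained from $L$ by adding new constants $d_j$, $j\in\mathbb N$, a code $\gamma$ consists of a pseudometric $\gamma\colon D^2\to[0,1]$ and functions $\gamma_R\colon D^k\to[0,1]$, one for each $k$-ary predicate symbol $R$ of $L$, such that the operations $(t_1,\dots,t_k)\mapsto f(t_1,\dots,t_k)$ on $D$, for function symbols $f$ of $L$, and the functions $\gamma_R$ respect the prescribed moduli of uniform continuity with respect to $\gamma$. The topology on $\hat{\mathcal M}(L)$ is that of pointwise convergence, and $M(\gamma)$ is the $L$-structure obtained by completing $D$ with respect to $\gamma$ (identifying points at distance $0$). For an $L$-theory $\mathbf T$ (a set of sentences; $M\models\mathbf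 T$ if all of them have value $0$ in $M$), the space of separable models of $\mathbf T$ is the subspace $\{\gamma\in\hat{\mathcal M}(L): M(\gamma)\models\mathbf T\}$. A sequence $\langle \mathbf t_n:n\in\mathbb N\rangle$ of $m$-ary types is \emph{uniform} if there are $m$-ary formulas $\phi_i$, $i\in\mathbb N$, all with the same modulus of uniform continuity, such that $\mathbf t_n=\{\phi_i(\bar x)\ge 2^{-n}: i\in\mathbb N\}$ for every $n$. A class $\mathfrak M$ of separable models of $\mathbf T$ is \emph{uniformly definable by omitting types} if there is a countable family of uniform sequences of types (of possibly different arities) such that a separable model of $\mathbf T$ belongs to $\mathfrak M$ if and only if it omits all the types in all of these sequences. **Proposition.** Let $\mathbf T$ be a theory in a separable language $L$. Then the space of separable models of $\mathbf T$ is a standard Borel space, and for every class $\mathfrak M$ of separable models of $\mathbf T$ that is uniformly definable by omitting types, the set of all $\gamma$ in this space with $M(\gamma)\in\mathfrak M$ is Borel. -/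

import Mathlib

universe u

open scoped unitInterval

noncomputable section

/-! ### Moduli of uniform continuity -/

/-- A modulus of uniform continuity `Δ : (0,1] → (0,1]`. -/
abbrev Modulus : Type := Set.Ioc (0 : ℝ) 1 → Set.Ioc (0 : ℝ) 1

/-- `f` respects the modulus `Δ`: for the maximum metric on `X ^ k`, `d(x,y) < Δ(ε)` implies
`d(f(x), f(y)) ≤ ε`. -/
def RespectsModulus {X Y : Type*} [PseudoMetricSpace X] [PseudoMetricSpace Y] (Δ : Modulus)
    {k : ℕ} (f : (Fin k → X) → Y) : Prop :=
  ∀ (ε : Set.Ioc (0 : ℝ) 1) (x y : Fin k → X),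
    (∀ i, dist (x i) (y i) < (Δ ε : ℝ)) → dist (f x) (f y) ≤ (ε : ℝ)

/-! ### Languages, structures and formulas of (single-sorted) logic of metric structures -/

/-- A language of the logic of metric structures: function and predicate symbols of all finite
arities (constants are the function symbols of arity `0`), each with a fixed modulus of uniform
continuity.  The distinguished symbol for the metric is a logical symbol. -/
structure MetricLanguage extends FirstOrder.Language.{u, u} where
  funModulus : ∀ {k : ℕ}, toLanguage.Functions k → Modulus
  relModulus : ∀ {k : ℕ}, toLanguage.Relations k → Modulus

namespace MetricLanguage

/-- Terms with variables in `α`. -/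
abbrev Term (L : MetricLanguage.{u}) (α : Type) : Type u := L.toLanguage.Term α

/-- An `L`-structure: a nonempty complete metric space of diameter at most `1`, with
interpretations of the symbols of `L` that respect the prescribed moduli. -/
structure Str (L : MetricLanguage.{u}) : Type (u + 1) where
  carrier : Type u
  [metric : MetricSpace carrier]
  [complete : CompleteSpace carrier]
  [nonempty : Nonempty carrier]
  dist_le_one : ∀ x y : carrier, dist x y ≤ 1
  funMap : ∀ {k : ℕ}, L.Functions k → (Fin k → carrier) → carrier
  relMap : ∀ {k : ℕ}, L.Relations k → (Fin k → carrier) → I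
  funMap_respects : ∀ {k : ℕ} (f : L.Functions k), RespectsModulus (L.funModulus f) (funMap f)
  relMap_respects : ∀ {k : ℕ} (R : L.Relations k), RespectsModulus (L.relModulus R) (relMap R)

instance (L : MetricLanguage.{u}) : CoeSort L.Str (Type u) := ⟨Str.carrier⟩
instance {L : MetricLanguage.{u}} (M : L.Str) : MetricSpace M := M.metric
instance {L : MetricLanguage.{u}} (M : L.Str) : CompleteSpace M := M.complete
instance {L : MetricLanguage.{u}} (M : L.Str) : Nonempty M := M.nonempty

/-- Interpretation of a term under an assignment of its variables. -/
def Str.termVal {L : MetricLanguage.{u}} (M : L.Str) {α : Type} (v : α → M) : L.Term α → M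
  | .var a => v a
  | .func f ts => M.funMap f fun i => M.termVal v (ts i)

/-- `L.Formula n` is the set of `[0,1]`-valued `L`-formulas whose free variables are among
`x_0, …, x_{n-1}`.  Connectives are all continuous functions `[0,1]^k → [0,1]`; the quantifiers
`sup` and `inf` bind the last variable. -/
inductive Formula (L : MetricLanguage.{u}) : ℕ → Type u
  | dist {n : ℕ} (s t : L.Term (Fin n)) : Formula L n
  | rel {n k : ℕ} (R : L.Relations k) (ts : Fin k → L.Term (Fin n)) : Formula L n
  | conn {n k : ℕ} (c : C(Fin k → I, I)) (φs : Fin k → Formula L n) : Formula L n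
  | sup {n : ℕ} (φ : Formula L (n + 1)) : Formula L n
  | inf {n : ℕ} (φ : Formula L (n + 1)) : Formula L n

/-- The value `φ(a)^M`. -/
def Str.eval {L : MetricLanguage.{u}} (M : L.Str) : {n : ℕ} → L.Formula n → (Fin n → M) → I
  | _, .dist s t, a => ⟨Dist.dist (M.termVal a s) (M.termVal a t), dist_nonneg, M.dist_le_one _ _⟩
  | _, .rel R ts, a => M.relMap R fun i => M.termVal a (ts i)
  | _, .conn c φs, a => c fun i => M.eval (φs i) a
  | _, .sup φ, a => ⨆ b : M, M.eval φ (Fin.snoc a b)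
  | _, .inf φ, a => ⨅ b : M, M.eval φ (Fin.snoc a b)

/-- `‖φ - ψ‖_∞ ≤ r`, where the norm is the supremum over all `L`-structures `M` and all tuples
in `M`. -/
def Formula.NormSubLE {L : MetricLanguage.{u}} {n : ℕ} (φ ψ : L.Formula n) (r : ℝ) : Prop :=
  ∀ (M : L.Str) (a : Fin n → M), |(M.eval φ a : ℝ) - M.eval ψ a| ≤ r

/-- The language `L` is separable: for every `n` the space of formulas in `x_0, …, x_{n-1}` is
separable with respect to `‖·‖_∞`. -/
def IsSeparable (L : MetricLanguage.{u}) : Prop :=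
  ∀ n : ℕ, ∃ S : Set (L.Formula n), S.Countable ∧
    ∀ (φ : L.Formula n) (r : ℝ), 0 < r → ∃ ψ ∈ S, φ.NormSubLE ψ r

/-- A theory is a set of sentences. -/
abbrev Theory (L : MetricLanguage.{u}) : Type u := Set (L.Formula 0)

/-- `M` is a model of `T`: all sentences of `T` have value `0` in `M`. -/
def Str.Models {L : MetricLanguage.{u}} (M : L.Str) (T : L.Theory) : Prop :=
  ∀ φ ∈ T, M.eval φ Fin.elim0 = 0

/-! ### Types -/

/-- A closed condition `φ(x_0, …, x_{n-1}) ∈ K`, with `K ⊆ ℝ` closed. -/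
structure Condition (L : MetricLanguage.{u}) (n : ℕ) : Type u where
  formula : L.Formula n
  set : Set ℝ
  isClosed : IsClosed set

/-- The condition `φ(x) ≥ r`. -/
def Formula.ge {L : MetricLanguage.{u}} {n : ℕ} (φ : L.Formula n) (r : ℝ) : L.Condition n :=
  ⟨φ, Set.Ici r, isClosed_Ici⟩

/-- A (partial) type in the variables `x_0, …, x_{n-1}` is a set of closed conditions. -/
abbrev PartialType (L : MetricLanguage.{u}) (n : ℕ) : Type u := Set (L.Condition n)

/-- The tuple `a` realizes the type `t` in `M`. -/
def Str.Realizes {L : MetricLanguage.{u}} (M : L.Str) {n : ℕ} (a : Fin n → M)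
    (t : L.PartialType n) : Prop :=
  ∀ c ∈ t, (M.eval c.formula a : ℝ) ∈ c.set

/-- `M` omits the type `t`. -/
def Str.Omits {L : MetricLanguage.{u}} (M : L.Str) {n : ℕ} (t : L.PartialType n) : Prop :=
  ¬ ∃ a : Fin n → M, M.Realizes a t

/-- `Δ` is a modulus of uniform continuity of the formula `φ` (in every `L`-structure). -/
def Formula.HasModulus {L : MetricLanguage.{u}} {n : ℕ} (φ : L.Formula n) (Δ : Modulus) : Prop :=
  ∀ M : L.Str, RespectsModulus Δ (M.eval φ)

/-- A sequence `t_0, t_1, …` of `n`-ary types is uniform if there are `n`-ary formulas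
`φ_0, φ_1, …`, all with the same modulus of uniform continuity, such that
`t_j = {φ_i ≥ 2 ^ (-j) : i ∈ ℕ}` for every `j`. -/
def IsUniformSequence {L : MetricLanguage.{u}} {n : ℕ} (t : ℕ → L.PartialType n) : Prop :=
  ∃ φ : ℕ → L.Formula n,
    (∀ j : ℕ, t j = Set.range fun i => (φ i).ge ((2 : ℝ)⁻¹ ^ j)) ∧
    ∃ Δ : Modulus, ∀ i, (φ i).HasModulus Δ

/-- `𝔐` is a class of separable models of `T` that is uniformly definable by omitting types: there
is a countable family of uniform sequences of types such that a separable model of `T` is in `𝔐`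
if and only if it omits all of these types. -/
def UniformlyDefinableByOmittingTypes {L : MetricLanguage.{u}} (T : L.Theory)
    (𝔐 : Set L.Str) : Prop :=
  ∃ (J : Type) (_ : Countable J) (n : J → ℕ) (t : (m : J) → ℕ → L.PartialType (n m)),
    (∀ m, IsUniformSequence (t m)) ∧
    ∀ M : L.Str, M ∈ 𝔐 ↔
      TopologicalSpace.SeparableSpace M ∧ M.Models T ∧ ∀ m j, M.Omits (t m j)

/-! ### The space of separable structures

The new constants `d_0, d_1, …` are the variables of the terms in `L.Term ℕ`, so that `L.Term ℕ` is
the set of closed terms of the language `L ∪ {d_j : j ∈ ℕ}`. -/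

/-- The product of copies of `[0,1]` in which structures are coded: a function of two terms (the
metric) and, for every `k`-ary predicate symbol, a function of `k` terms. -/
abbrev RawCode (L : MetricLanguage.{u}) : Type u :=
  (L.Term ℕ → L.Term ℕ → I) × ((R : Σ k, L.Relations k) → (Fin R.1 → L.Term ℕ) → I)

/-- `γ` is a code: its first component is a (pseudo)metric on the set of terms, and the function
and predicate symbols respect their moduli with respect to it. -/
structure IsCode {L : MetricLanguage.{u}} (γ : L.RawCode) : Prop where
  self : ∀ s, γ.1 s s = 0
  symm : ∀ s t, γ.1 s t = γ.1 t s
  triangle : ∀ s t r, (γ.1 s r : ℝ) ≤ γ.1 s t + γ.1 t r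
  func : ∀ {k : ℕ} (f : L.Functions k) (ε : Set.Ioc (0 : ℝ) 1) (s t : Fin k → L.Term ℕ),
    (∀ i, (γ.1 (s i) (t i) : ℝ) < (L.funModulus f ε : ℝ)) →
      (γ.1 (.func f s) (.func f t) : ℝ) ≤ ε
  rel : ∀ {k : ℕ} (R : L.Relations k) (ε : Set.Ioc (0 : ℝ) 1) (s t : Fin k → L.Term ℕ),
    (∀ i, (γ.1 (s i) (t i) : ℝ) < (L.relModulus R ε : ℝ)) →
      |(γ.2 ⟨k, R⟩ s : ℝ) - γ.2 ⟨k, R⟩ t| ≤ ε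

/-- The space of (codes of) separable `L`-structures. -/
def Code (L : MetricLanguage.{u}) : Type u := {γ : L.RawCode // IsCode γ}

/-- The topology induced by the product topology. -/
instance (L : MetricLanguage.{u}) : TopologicalSpace L.Code :=
  inferInstanceAs (TopologicalSpace {γ : L.RawCode // IsCode γ})

instance (L : MetricLanguage.{u}) : MeasurableSpace L.Code := borel _

instance (L : MetricLanguage.{u}) : BorelSpace L.Code := ⟨rfl⟩

namespace Code

variable {L : MetricLanguage.{u}}

/-- The set of terms, with the pseudometric coded by `γ`. -/
def Pre (_ : L.Code) : Type u := L.Term ℕ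

instance (γ : L.Code) : Nonempty γ.Pre := ⟨(.var 0 : L.Term ℕ)⟩

instance (γ : L.Code) : PseudoMetricSpace γ.Pre where
  dist s t := (γ.1.1 s t : ℝ)
  dist_self s := by simp [γ.2.self s]
  dist_comm s t := by rw [γ.2.symm s t]
  dist_triangle s t r := γ.2.triangle s t r

instance (γ : L.Code) : Nonempty (UniformSpace.Completion γ.Pre) :=
  (inferInstance : Nonempty γ.Pre).map (↑)

/-- Interpretation of a function symbol on terms. -/
def preFun (γ : L.Code) {k : ℕ} (f : L.Functions k) (s : Fin k → γ.Pre) : γ.Pre :=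
  FirstOrder.Language.Term.func f s

/-- Interpretation of a predicate symbol on terms. -/
def preRel (γ : L.Code) {k : ℕ} (R : L.Relations k) (s : Fin k → γ.Pre) : I := γ.1.2 ⟨k, R⟩ s

theorem preFun_respects (γ : L.Code) {k : ℕ} (f : L.Functions k) :
    RespectsModulus (L.funModulus f) (γ.preFun f) := γ.2.func f

theorem preRel_respects (γ : L.Code) {k : ℕ} (R : L.Relations k) :
    RespectsModulus (L.relModulus R) (γ.preRel R) := γ.2.rel R

end Code

end MetricLanguage

open UniformSpace in
/-- The inclusion of `X ^ k` into the `k`-th power of the completion of `X`. -/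
theorem isDenseInducing_pi_completion (X : Type*) [PseudoMetricSpace X] (k : ℕ) :
    IsDenseInducing (fun (x : Fin k → X) (i : Fin k) => (x i : Completion X)) :=
  ⟨Topology.IsInducing.piMap fun _ => Completion.isDenseInducing_coe.isInducing,
    DenseRange.piMap fun _ => Completion.denseRange_coe⟩

open UniformSpace in
/-- The continuous extension of `f : X ^ k → Y` to the completion of `X`. -/
def extendCompletion {X Y : Type*} [PseudoMetricSpace X] [TopologicalSpace Y] [Nonempty Y]
    {k : ℕ} (f : (Fin k → X) → Y) : (Fin k → Completion X) → Y :=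
  (isDenseInducing_pi_completion X k).extend f

theorem RespectsModulus.uniformContinuous {X Y : Type*} [PseudoMetricSpace X]
    [PseudoMetricSpace Y] {Δ : Modulus} {k : ℕ} {f : (Fin k → X) → Y}
    (h : RespectsModulus Δ f) : UniformContinuous f := by
  rw [Metric.uniformContinuous_iff]
  intro ε hε
  let e : Set.Ioc (0 : ℝ) 1 := ⟨min (ε / 2) 1, by positivity, min_le_right _ _⟩
  refine ⟨Δ e, (Δ e).2.1, fun x y hxy => ?_⟩
  have h1 := h e x y fun i => (dist_le_pi_dist x y i).trans_lt hxy
  have h2 : (e : ℝ) ≤ ε / 2 := min_le_left _ _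
  linarith

theorem extendCompletion_spec {X Y : Type*} [PseudoMetricSpace X] [MetricSpace Y]
    [CompleteSpace Y] [Nonempty Y] {Δ : Modulus} {k : ℕ} {f : (Fin k → X) → Y}
    (h : RespectsModulus Δ f) :
    UniformContinuous (extendCompletion f) ∧
      ∀ x : Fin k → X, extendCompletion f (fun i => (x i : UniformSpace.Completion X)) = f x := by
  have hi : Isometry (fun (x : Fin k → X) (i : Fin k) => (x i : UniformSpace.Completion X)) :=
    Isometry.piMap _ fun _ => UniformSpace.Completion.coe_isometry
  have hd := (isDenseInducing_pi_completion X k).dense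
  exact ⟨uniformContinuous_uniformly_extend hi.isUniformInducing hd h.uniformContinuous,
    fun x => (isDenseInducing_pi_completion X k).extend_eq h.uniformContinuous.continuous x⟩

theorem RespectsModulus.extendCompletion {X Y : Type*} [PseudoMetricSpace X] [MetricSpace Y]
    [CompleteSpace Y] [Nonempty Y] {Δ : Modulus} {k : ℕ} {f : (Fin k → X) → Y}
    (h : RespectsModulus Δ f) : RespectsModulus Δ (extendCompletion f) := by
  obtain ⟨hc, he⟩ := extendCompletion_spec h
  intro ε
  by_contra! hcon
  obtain ⟨x, y, hxy, hlt⟩ := hcon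
  let U : Set ((Fin k → UniformSpace.Completion X) × (Fin k → UniformSpace.Completion X)) :=
    {p | (∀ i, dist (p.1 i) (p.2 i) < (Δ ε : ℝ)) ∧
      (ε : ℝ) < dist (_root_.extendCompletion f p.1) (_root_.extendCompletion f p.2)}
  have hU : IsOpen U := by
    refine IsOpen.and ?_ ?_
    · rw [Set.ofPred_forall]
      exact isOpen_iInter_of_finite fun i => isOpen_lt (by fun_prop) continuous_const
    · exact isOpen_lt continuous_const
        ((hc.continuous.comp continuous_fst).dist (hc.continuous.comp continuous_snd))
  have hd := (isDenseInducing_pi_completion X k).dense.prodMap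
    (isDenseInducing_pi_completion X k).dense
  obtain ⟨⟨a, b⟩, hab1, hab2⟩ := hd.exists_mem_open hU ⟨(x, y), hxy, hlt⟩
  simp only [Prod.map_apply, he, UniformSpace.Completion.dist_eq] at hab1 hab2
  exact absurd (h ε a b hab1) (not_le.2 hab2)

namespace MetricLanguage

/-- The separable `L`-structure `M(γ)` coded by `γ`: the (Hausdorff) completion of the set of terms
with the pseudometric given by `γ`, the symbols of `L` being interpreted by continuity. -/
def Code.model {L : MetricLanguage.{u}} (γ : L.Code) : L.Str where
  carrier := UniformSpace.Completion γ.Pre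
  dist_le_one x y := by
    induction x, y using UniformSpace.Completion.induction_on₂ with
    | hp => exact isClosed_le (by fun_prop) continuous_const
    | ih s t =>
      rw [UniformSpace.Completion.dist_eq]
      exact (γ.1.1 s t).2.2
  funMap f := extendCompletion fun s => (γ.preFun f s : UniformSpace.Completion γ.Pre)
  relMap R := extendCompletion (γ.preRel R)
  funMap_respects f := RespectsModulus.extendCompletion fun ε s t h => by
    rw [UniformSpace.Completion.dist_eq]
    exact γ.preFun_respects f ε s t h
  relMap_respects R := (γ.preRel_respects R).extendCompletion

/-- The space of (codes of) separable models of `T`. -/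
abbrev ModelSpace {L : MetricLanguage.{u}} (T : L.Theory) : Type u :=
  {γ : L.Code // γ.model.Models T}

end MetricLanguage

end

/-! Distinct symbols of `L` give formulas at distance at least `1`, so separability makes the
symbols, and with them the closed terms, countable. Codes then form a closed subspace of a countable
power of `[0,1]`. As the terms are dense in `M(γ)` and formulas are continuous, quantifiers over
`M(γ)` can be replaced by quantifiers over terms, so every `γ ↦ φ(s)^M(γ)` is Borel. A theory is
equivalent to a countable dense subset of it. For a single type, realization cannot be tested on a
dense set; but in a uniform sequence the common modulus moves a tuple to a nearby tuple of terms at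
the cost of passing from `2⁻ʲ` to `2⁻⁽ʲ⁺¹⁾`, so that omitting the whole sequence is a countable
condition. -/

open scoped UniformConvergence

section UnitInterval

variable {ι X : Type*}

theorem coe_toFun_le_add_dist (f g : ι →ᵤ I) (i : ι) :
    ((UniformFun.toFun f i : I) : ℝ) ≤ UniformFun.toFun g i + dist f g :=
  sub_le_iff_le_add'.1 <|
    (le_abs_self _).trans ((UniformFun.dist_le (f := f) (g := g) dist_nonneg).1 le_rfl i)

theorem lipschitzWith_iSup_unitInterval [Nonempty ι] :
    LipschitzWith 1 fun f : ι →ᵤ I => ⨆ i, UniformFun.toFun f i := by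
  refine LipschitzWith.of_le_add fun f g => ?_
  rw [Set.Icc.coe_iSup zero_le_one (S := UniformFun.toFun f)]
  refine ciSup_le fun i => ?_
  calc ((UniformFun.toFun f i : I) : ℝ)
      ≤ UniformFun.toFun g i + dist f g := coe_toFun_le_add_dist f g i
    _ ≤ (⨆ j, UniformFun.toFun g j : I) + dist f g :=
        add_le_add_left (Subtype.coe_le_coe.2 (le_iSup (UniformFun.toFun g) i)) _

theorem lipschitzWith_iInf_unitInterval [Nonempty ι] :
    LipschitzWith 1 fun f : ι →ᵤ I => ⨅ i, UniformFun.toFun f i := by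
  refine LipschitzWith.of_le_add fun f g => ?_
  rw [← sub_le_iff_le_add, Set.Icc.coe_iInf zero_le_one (S := UniformFun.toFun g)]
  refine le_ciInf fun i => sub_le_iff_le_add.2 ?_
  calc ((⨅ j, UniformFun.toFun f j : I) : ℝ)
      ≤ UniformFun.toFun f i := Subtype.coe_le_coe.2 (iInf_le (UniformFun.toFun f) i)
    _ ≤ UniformFun.toFun g i + dist f g := coe_toFun_le_add_dist f g i

variable [UniformSpace X] [Nonempty ι] {f : ι → X → I}

theorem uniformContinuous_iSup_unitInterval (hf : UniformEquicontinuous f) :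
    UniformContinuous fun x => ⨆ i, f i x :=
  lipschitzWith_iSup_unitInterval.uniformContinuous.comp
    (uniformEquicontinuous_iff_uniformContinuous.1 hf)

theorem uniformContinuous_iInf_unitInterval (hf : UniformEquicontinuous f) :
    UniformContinuous fun x => ⨅ i, f i x :=
  lipschitzWith_iInf_unitInterval.uniformContinuous.comp
    (uniformEquicontinuous_iff_uniformContinuous.1 hf)

end UnitInterval

section PseudoMetric

variable {X : Type*} [PseudoMetricSpace X]

theorem countable_of_pairwise_le_dist [TopologicalSpace.SeparableSpace X] {ι : Type*} {f : ι → X}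
    {r : ℝ} (hr : 0 < r) (hf : Pairwise fun i j => r ≤ dist (f i) (f j)) : Countable ι :=
  Pairwise.countable_of_isOpen_disjoint (s := fun i => Metric.ball (f i) (r / 2))
    (fun i j hij => Metric.ball_disjoint_ball (by linarith [hf hij]))
    (fun _ => Metric.isOpen_ball) fun _ => Metric.nonempty_ball.2 (half_pos hr)

theorem lipschitzWith_finSnoc_left {n : ℕ} (b : X) :
    LipschitzWith 1 fun a : Fin n → X => (Fin.snoc a b : Fin (n + 1) → X) := by
  refine LipschitzWith.of_dist_le_mul fun a a' => ?_
  rw [NNReal.coe_one, one_mul]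
  refine (dist_pi_le_iff dist_nonneg).2 fun i => ?_
  induction i using Fin.lastCases with
  | last => simp only [Fin.snoc_last, dist_self, dist_nonneg]
  | cast i => simpa only [Fin.snoc_castSucc] using dist_le_pi_dist a a' i

theorem respectsModulus_const {Y : Type*} [PseudoMetricSpace Y] (Δ : Modulus) {k : ℕ} (c : Y) :
    RespectsModulus Δ fun _ : Fin k → X => c := fun ε _ _ _ => by
  rw [dist_self]
  exact ε.2.1.le

theorem RespectsModulus.exists_lt_add_of_denseRange {ι α : Type*} {Δ : Modulus} {k : ℕ}
    {f : ι → (Fin k → X) → I} (hf : ∀ i, RespectsModulus Δ (f i)) {e : α → X}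
    (he : DenseRange e) {r : ℝ} (h : ∀ s : Fin k → α, ∃ i, (f i fun l => e (s l) : ℝ) < r)
    (ε : Set.Ioc (0 : ℝ) 1) (a : Fin k → X) : ∃ i, (f i a : ℝ) < r + ε := by
  choose s hs using fun l => he.exists_dist_lt (a l) (Δ ε).2.1
  obtain ⟨i, hi⟩ := h s
  have hclose : (f i a : ℝ) - f i (fun l => e (s l)) ≤ ε :=
    (le_abs_self _).trans (hf i ε _ _ hs)
  exact ⟨i, by linarith⟩

end PseudoMetric

theorem isClosed_setOf_forall_lt_imp_le {Z X : Type*} [TopologicalSpace Z] {k : ℕ}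
    {d : Z → X → X → ℝ} {e : Z → (Fin k → X) → (Fin k → X) → ℝ}
    (hd : ∀ x y, Continuous fun z => d z x y) (he : ∀ x y, Continuous fun z => e z x y)
    (Δ : Modulus) :
    IsClosed {z | ∀ (ε : Set.Ioc (0 : ℝ) 1) (x y : Fin k → X),
      (∀ i, d z (x i) (y i) < (Δ ε : ℝ)) → e z x y ≤ ε} := by
  simp only [Set.ofPred_forall]
  refine isClosed_iInter fun ε => isClosed_iInter fun x => isClosed_iInter fun y =>
    isClosed_imp ?_ (isClosed_le (he x y) continuous_const)
  rw [Set.ofPred_forall]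
  exact isOpen_iInter_of_finite fun i => isOpen_lt (hd _ _) continuous_const

namespace MetricLanguage

variable {L : MetricLanguage.{u}}

/-! ### The space of formulas -/

namespace Formula

variable {n : ℕ}

/-- The interpretation of a formula as a function on pairs of a structure and a tuple in it, with
the uniformity of uniform convergence. -/
noncomputable def interp (φ : L.Formula n) : (Σ M : L.Str, Fin n → M) →ᵤ I :=
  UniformFun.ofFun fun p => p.1.eval φ p.2

/-- The distance `‖φ - ψ‖_∞`. -/
noncomputable instance : PseudoMetricSpace (L.Formula n) := .induced interp inferInstance

theorem dist_le_iff_normSubLE {φ ψ : L.Formula n} {r : ℝ} (hr : 0 ≤ r) :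
    Dist.dist φ ψ ≤ r ↔ φ.NormSubLE ψ r :=
  (UniformFun.dist_le hr).trans Sigma.forall

theorem abs_eval_sub_eval_le_dist (φ ψ : L.Formula n) (M : L.Str) (a : Fin n → M) :
    |(M.eval φ a : ℝ) - M.eval ψ a| ≤ Dist.dist φ ψ :=
  (dist_le_iff_normSubLE dist_nonneg).1 le_rfl M a

theorem continuous_eval_left (M : L.Str) (a : Fin n → M) :
    Continuous fun φ : L.Formula n => M.eval φ a :=
  (LipschitzWith.mk_one fun φ ψ => abs_eval_sub_eval_le_dist φ ψ M a).continuous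

end Formula

theorem IsSeparable.separableSpace_formula (hL : L.IsSeparable) (n : ℕ) :
    TopologicalSpace.SeparableSpace (L.Formula n) := by
  obtain ⟨S, hS, hdense⟩ := hL n
  refine ⟨S, hS, Metric.dense_iff.2 fun φ r hr => ?_⟩
  obtain ⟨ψ, hψS, hψ⟩ := hdense φ (r / 2) (half_pos hr)
  have hdist : dist φ ψ ≤ r / 2 := (Formula.dist_le_iff_normSubLE (half_pos hr).le).2 hψ
  exact ⟨ψ, Metric.mem_ball'.2 (hdist.trans_lt (half_lt_self hr)), hψS⟩

theorem IsSeparable.exists_countable_models_iff (hL : L.IsSeparable) (T : L.Theory) :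
    ∃ S : L.Theory, S.Countable ∧ ∀ M : L.Str, M.Models T ↔ M.Models S := by
  have := hL.separableSpace_formula 0
  obtain ⟨S, hST, hS, hTS⟩ :=
    (TopologicalSpace.IsSeparable.of_separableSpace T).exists_countable_dense_subset
  refine ⟨S, hS, fun M => ⟨fun hT φ hφ => hT φ (hST hφ), fun hM φ hφ => ?_⟩⟩
  have hclosed : IsClosed {φ : L.Formula 0 | M.eval φ Fin.elim0 = 0} :=
    isClosed_eq (Formula.continuous_eval_left M _) continuous_const
  exact closure_minimal hM hclosed (hTS hφ)

/-! ### Separable languages are countable -/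

/-- The structure on the unit interval (lifted to the universe of `L`) in which every symbol is
interpreted by a constant map; it serves to tell symbols apart. -/
noncomputable def constStr (F : (Σ k, L.Functions k) → I) (P : (Σ k, L.Relations k) → I) :
    L.Str where
  carrier := ULift.{u} I
  dist_le_one x y := Real.dist_le_of_mem_Icc_01 x.down.2 y.down.2
  funMap f _ := ⟨F ⟨_, f⟩⟩
  relMap R _ := P ⟨_, R⟩
  funMap_respects _ := respectsModulus_const _ _
  relMap_respects _ := respectsModulus_const _ _

theorem eval_constStr_dist_func (F : (Σ k, L.Functions k) → I) (P : (Σ k, L.Relations k) → I)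
    {n k : ℕ} (f : L.Functions k) (ts : Fin k → L.Term (Fin n)) (i : Fin n) :
    (constStr F P).eval (.dist (.func f ts) (.var i)) (fun _ => ⟨0⟩) = F ⟨k, f⟩ :=
  Subtype.ext <| calc
    dist (F ⟨k, f⟩ : ℝ) 0 = |(F ⟨k, f⟩ : ℝ)| := Real.dist_0_eq_abs _
    _ = F ⟨k, f⟩ := abs_of_nonneg (F ⟨k, f⟩).2.1

theorem IsSeparable.countable_of_forall_exists_eval_eq (hL : L.IsSeparable) {n : ℕ} {ι : Type*}
    (φ : ι → L.Formula n)
    (h : ∀ i, ∃ (M : L.Str) (a : Fin n → M), M.eval (φ i) a = 1 ∧ ∀ j ≠ i, M.eval (φ j) a = 0) :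
    Countable ι := by
  have := hL.separableSpace_formula n
  refine countable_of_pairwise_le_dist (f := φ) one_pos fun i j hij => ?_
  obtain ⟨M, a, hi, hj⟩ := h i
  simpa [hi, hj j hij.symm] using Formula.abs_eval_sub_eval_le_dist (φ i) (φ j) M a

theorem IsSeparable.countable_relations (hL : L.IsSeparable) : Countable (Σ k, L.Relations k) := by
  classical
  refine hL.countable_of_forall_exists_eval_eq (n := 1) (fun R => .rel R.2 fun _ => .var 0)
    fun R => ⟨constStr 0 (Pi.single R 1), fun _ => ⟨0⟩, ?_, fun Q hQ => ?_⟩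
  · exact Pi.single_eq_same R 1
  · exact Pi.single_eq_of_ne hQ 1

theorem IsSeparable.countable_functions (hL : L.IsSeparable) : Countable (Σ k, L.Functions k) := by
  classical
  refine hL.countable_of_forall_exists_eval_eq (n := 1)
    (fun f => .dist (.func f.2 fun _ => .var 0) (.var 0))
    fun f => ⟨constStr (Pi.single f 1) 0, fun _ => ⟨0⟩, ?_, fun g hg => ?_⟩
  · rw [eval_constStr_dist_func, Pi.single_eq_same]
  · rw [eval_constStr_dist_func, Pi.single_eq_of_ne hg]

theorem IsSeparable.countable_term (hL : L.IsSeparable) : Countable (L.Term ℕ) :=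
  have := hL.countable_functions
  inferInstance

/-! ### The space of codes is Polish -/

theorem isClosed_setOf_isCode : IsClosed {γ : L.RawCode | IsCode γ} := by
  have hd : ∀ s t, Continuous fun γ : L.RawCode => (γ.1 s t : ℝ) := fun s t => by fun_prop
  have hr : ∀ R s, Continuous fun γ : L.RawCode => (γ.2 R s : ℝ) := fun R s => by fun_prop
  have hself : IsClosed {γ : L.RawCode | ∀ s, γ.1 s s = 0} := by
    simp only [Set.ofPred_forall]
    exact isClosed_iInter fun s => isClosed_eq (by fun_prop) continuous_const
  have hsymm : IsClosed {γ : L.RawCode | ∀ s t, γ.1 s t = γ.1 t s} := by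
    simp only [Set.ofPred_forall]
    exact isClosed_iInter fun s => isClosed_iInter fun t => isClosed_eq (by fun_prop) (by fun_prop)
  have htriangle : IsClosed {γ : L.RawCode | ∀ s t r, (γ.1 s r : ℝ) ≤ γ.1 s t + γ.1 t r} := by
    simp only [Set.ofPred_forall]
    exact isClosed_iInter fun s => isClosed_iInter fun t => isClosed_iInter fun r =>
      isClosed_le (hd _ _) ((hd _ _).add (hd _ _))
  have hfunc := isClosed_iInter fun f : Σ k, L.Functions k =>
    isClosed_setOf_forall_lt_imp_le hd (fun s t => hd (.func f.2 s) (.func f.2 t))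
      (L.funModulus f.2)
  have hrel := isClosed_iInter fun R : Σ k, L.Relations k =>
    isClosed_setOf_forall_lt_imp_le hd (fun s t => ((hr R s).sub (hr R t)).abs)
      (L.relModulus R.2)
  convert hself.inter (hsymm.inter (htriangle.inter (hfunc.inter hrel))) using 1
  ext γ
  simp only [Set.mem_inter_iff, Set.mem_iInter]
  exact ⟨fun h => ⟨h.self, h.symm, h.triangle, fun f => h.func f.2, fun R => h.rel R.2⟩,
    fun ⟨hself, hsymm, htriangle, hfunc, hrel⟩ =>
      ⟨hself, hsymm, htriangle, fun f => hfunc ⟨_, f⟩, fun R => hrel ⟨_, R⟩⟩⟩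

theorem polishSpace_code [Countable (L.Term ℕ)] [Countable (Σ k, L.Relations k)] :
    PolishSpace L.Code :=
  have : PolishSpace I := isClosed_Icc.polishSpace
  isClosed_setOf_isCode.polishSpace

/-! ### Formulas are uniformly continuous -/

namespace Str

variable (M : L.Str) {n : ℕ}

theorem uniformContinuous_termVal (t : L.Term (Fin n)) :
    UniformContinuous fun a : Fin n → M => M.termVal a t := by
  induction t with
  | var i => exact Pi.uniformContinuous_proj _ i
  | func f ts ih => exact (M.funMap_respects f).uniformContinuous.comp (uniformContinuous_pi.2 ih)

theorem uniformContinuous_eval (φ : L.Formula n) : UniformContinuous (M.eval φ) := by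
  have uniformEquicontinuous_snoc {n : ℕ} {φ : L.Formula (n + 1)}
      (hφ : UniformContinuous (M.eval φ)) :
      UniformEquicontinuous fun (b : M) (a : Fin n → M) => M.eval φ (Fin.snoc a b) :=
    fun U hU => LipschitzWith.uniformEquicontinuous _ 1 lipschitzWith_finSnoc_left _ (hφ hU)
  induction φ with
  | dist s t =>
    exact ((M.uniformContinuous_termVal s).dist (M.uniformContinuous_termVal t)).subtype_mk _
  | rel R ts =>
    exact (M.relMap_respects R).uniformContinuous.comp
      (uniformContinuous_pi.2 fun i => M.uniformContinuous_termVal (ts i))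
  | conn c φs ih =>
    exact (CompactSpace.uniformContinuous_of_continuous c.continuous).comp
      (uniformContinuous_pi.2 ih)
  | sup φ ih => exact uniformContinuous_iSup_unitInterval (uniformEquicontinuous_snoc ih)
  | inf φ ih => exact uniformContinuous_iInf_unitInterval (uniformEquicontinuous_snoc ih)

theorem continuous_eval_snoc (φ : L.Formula (n + 1)) (a : Fin n → M) :
    Continuous fun b : M => M.eval φ (Fin.snoc a b) :=
  (M.uniformContinuous_eval φ).continuous.comp (continuous_const.finSnoc continuous_id)

theorem omits_range_ge_iff (φ : ℕ → L.Formula n) (r : ℝ) :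
    M.Omits (Set.range fun i => (φ i).ge r) ↔ ∀ a : Fin n → M, ∃ i, (M.eval (φ i) a : ℝ) < r := by
  simp only [Omits, Realizes, Set.forall_mem_range, not_exists, not_forall, Formula.ge,
    Set.mem_Ici, not_le]

end Str

/-! ### Values of formulas at terms -/

namespace Code

variable {n : ℕ}

/-- The element of `M(γ)` named by a closed term. -/
def point (γ : L.Code) (t : L.Term ℕ) : γ.model :=
  UniformSpace.Completion.coe' (α := γ.Pre) t

/-- The value `φ(s)^M(γ)` at the elements named by the closed terms `s`. -/
noncomputable def value (γ : L.Code) (φ : L.Formula n) (s : Fin n → L.Term ℕ) : I :=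
  γ.model.eval φ fun i => γ.point (s i)

theorem continuous_val : Continuous fun γ : L.Code => γ.1 :=
  continuous_subtype_val

section

variable (γ : L.Code)

theorem denseRange_point : DenseRange γ.point :=
  UniformSpace.Completion.denseRange_coe (α := γ.Pre)

theorem dist_point (s t : L.Term ℕ) : dist (γ.point s) (γ.point t) = γ.1.1 s t :=
  UniformSpace.Completion.dist_eq (α := γ.Pre) s t

theorem funMap_point {k : ℕ} (f : L.Functions k) (s : Fin k → L.Term ℕ) :
    γ.model.funMap f (fun i => γ.point (s i)) = γ.point (.func f s) := by
  have hf : RespectsModulus (L.funModulus f)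
      fun s => (γ.preFun f s : UniformSpace.Completion γ.Pre) := fun ε s t hst => by
    rw [UniformSpace.Completion.dist_eq]
    exact γ.preFun_respects f ε s t hst
  exact (extendCompletion_spec hf).2 s

theorem relMap_point {k : ℕ} (R : L.Relations k) (s : Fin k → L.Term ℕ) :
    γ.model.relMap R (fun i => γ.point (s i)) = γ.1.2 ⟨k, R⟩ s :=
  (extendCompletion_spec (γ.preRel_respects R)).2 s

theorem termVal_point (s : Fin n → L.Term ℕ) (t : L.Term (Fin n)) :
    γ.model.termVal (fun i => γ.point (s i)) t = γ.point (t.subst s) := by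
  induction t with
  | var i => rfl
  | func f ts ih => simp only [Str.termVal, ih, funMap_point, FirstOrder.Language.Term.subst]

theorem value_dist (t t' : L.Term (Fin n)) (s : Fin n → L.Term ℕ) :
    γ.value (.dist t t') s = γ.1.1 (t.subst s) (t'.subst s) := by
  refine Subtype.ext ?_
  simp only [value, Str.eval, termVal_point, dist_point]

theorem value_rel {k : ℕ} (R : L.Relations k) (ts : Fin k → L.Term (Fin n))
    (s : Fin n → L.Term ℕ) :
    γ.value (.rel R ts) s = γ.1.2 ⟨k, R⟩ fun i => (ts i).subst s := by
  simp only [value, Str.eval, termVal_point, relMap_point]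

theorem value_snoc (φ : L.Formula (n + 1)) (s : Fin n → L.Term ℕ) (t : L.Term ℕ) :
    γ.value φ (Fin.snoc s t) =
      γ.model.eval φ (Fin.snoc (fun i => γ.point (s i)) (γ.point t)) :=
  congrArg (γ.model.eval φ) (Fin.comp_snoc γ.point s t)

theorem value_sup (φ : L.Formula (n + 1)) (s : Fin n → L.Term ℕ) :
    γ.value (.sup φ) s = ⨆ t, γ.value φ (Fin.snoc s t) := by
  simp only [value_snoc]
  exact (γ.denseRange_point.ciSup' (γ.model.continuous_eval_snoc φ _)).symm.trans
    (iSup_range' (fun b => γ.model.eval φ (Fin.snoc (fun i => γ.point (s i)) b)) γ.point)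

theorem value_inf (φ : L.Formula (n + 1)) (s : Fin n → L.Term ℕ) :
    γ.value (.inf φ) s = ⨅ t, γ.value φ (Fin.snoc s t) := by
  simp only [value_snoc]
  exact (γ.denseRange_point.ciInf' (γ.model.continuous_eval_snoc φ _)).symm.trans
    (iInf_range' (fun b => γ.model.eval φ (Fin.snoc (fun i => γ.point (s i)) b)) γ.point)

theorem models_iff_forall_value_eq_zero (T : L.Theory) :
    γ.model.Models T ↔ ∀ φ ∈ T, γ.value φ Fin.elim0 = 0 := by
  simp only [Str.Models, value, Subsingleton.elim (fun i => γ.point (Fin.elim0 i)) Fin.elim0]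

theorem omits_iff_forall_exists_value_lt {φ : ℕ → L.Formula n} {Δ : Modulus}
    (hφ : ∀ i, (φ i).HasModulus Δ) :
    (∀ j : ℕ, γ.model.Omits (Set.range fun i => (φ i).ge ((2 : ℝ)⁻¹ ^ j))) ↔
      ∀ (j : ℕ) (s : Fin n → L.Term ℕ), ∃ i, (γ.value (φ i) s : ℝ) < (2 : ℝ)⁻¹ ^ j := by
  simp only [Str.omits_range_ge_iff]
  refine ⟨fun h j s => h j _, fun h j a => ?_⟩
  let ε : Set.Ioc (0 : ℝ) 1 :=
    ⟨(2 : ℝ)⁻¹ ^ (j + 1), by positivity, pow_le_one₀ (by norm_num) (by norm_num)⟩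
  have hsplit : (2 : ℝ)⁻¹ ^ j = (2 : ℝ)⁻¹ ^ (j + 1) + ε := by
    change _ = (2 : ℝ)⁻¹ ^ (j + 1) + (2 : ℝ)⁻¹ ^ (j + 1)
    ring
  rw [hsplit]
  exact RespectsModulus.exists_lt_add_of_denseRange (fun i => hφ i γ.model) γ.denseRange_point
    (h (j + 1)) ε a

variable [Countable (L.Term ℕ)]

theorem separableSpace_model : TopologicalSpace.SeparableSpace γ.model :=
  ⟨_, Set.countable_range _, γ.denseRange_point⟩

end

variable [Countable (L.Term ℕ)]

theorem measurable_value (φ : L.Formula n) (s : Fin n → L.Term ℕ) :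
    Measurable fun γ : L.Code => γ.value φ s := by
  induction φ with
  | dist t t' =>
    simp only [value_dist]
    exact Continuous.measurable <|
      (continuous_apply_apply _ _).comp (continuous_fst.comp continuous_val)
  | rel R ts =>
    simp only [value_rel]
    exact Continuous.measurable <| (continuous_apply _).comp <|
      (continuous_apply (⟨_, R⟩ : Σ k, L.Relations k)).comp <|
        continuous_snd.comp continuous_val
  | conn c φs ih => exact c.continuous.measurable.comp (measurable_pi_lambda _ fun i => ih i s)
  | sup φ ih =>
    simp only [value_sup]
    exact .iSup fun t => ih _
  | inf φ ih =>
    simp only [value_inf]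
    exact .iInf fun t => ih _

theorem measurableSet_setOf_models {T : L.Theory} (hT : T.Countable) :
    MeasurableSet {γ : L.Code | γ.model.Models T} := by
  simp only [models_iff_forall_value_eq_zero, Set.ofPred_forall]
  exact .biInter hT fun φ _ => measurable_value φ Fin.elim0 (measurableSet_singleton 0)

theorem measurableSet_setOf_forall_omits {t : ℕ → L.PartialType n} (ht : IsUniformSequence t) :
    MeasurableSet {γ : L.Code | ∀ j, γ.model.Omits (t j)} := by
  obtain ⟨φ, ht, Δ, hφ⟩ := ht
  simp only [ht, omits_iff_forall_exists_value_lt _ hφ, Set.ofPred_forall, Set.ofPred_exists]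
  exact .iInter fun j => .iInter fun s => .iUnion fun i =>
    measurableSet_lt (measurable_value (φ i) s).subtype_val measurable_const

end Code

theorem IsSeparable.standardBorelSpace_modelSpace (hL : L.IsSeparable) (T : L.Theory) :
    StandardBorelSpace (ModelSpace T) := by
  have := hL.countable_term
  have := hL.countable_relations
  have := polishSpace_code (L := L)
  obtain ⟨S, hS, hTS⟩ := hL.exists_countable_models_iff T
  have hmodels : MeasurableSet {γ : L.Code | γ.model.Models T} := by
    simpa only [hTS] using Code.measurableSet_setOf_models hS
  exact hmodels.standardBorel

end MetricLanguage

theorem propositionP (L : MetricLanguage.{u}) (hL : L.IsSeparable) (T : L.Theory)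
    (𝔐 : Set L.Str) (h𝔐 : MetricLanguage.UniformlyDefinableByOmittingTypes T 𝔐) :
    StandardBorelSpace (MetricLanguage.ModelSpace T) ∧
      MeasurableSet {γ : MetricLanguage.ModelSpace T | γ.1.model ∈ 𝔐} := by
  refine ⟨hL.standardBorelSpace_modelSpace T, ?_⟩
  have := hL.countable_term
  obtain ⟨J, _, n, t, ht, hmem⟩ := h𝔐
  have hset : {γ : MetricLanguage.ModelSpace T | γ.1.model ∈ 𝔐} =
      Subtype.val ⁻¹' ⋂ m, {γ : L.Code | ∀ j, γ.model.Omits (t m j)} := by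
    ext γ
    rw [Set.mem_preimage, Set.mem_iInter]
    exact (hmem _).trans ⟨fun h => h.2.2, fun h => ⟨γ.1.separableSpace_model, γ.2, h⟩⟩
  rw [hset]
  exact measurable_subtype_coe <| .iInter fun m =>
    MetricLanguage.Code.measurableSet_setOf_forall_omits (ht m)
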